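/- Consider the following two-party model. An array $A_0,\dots,A_{N-1}$ of integers in $[0,R]$ is split: Alice holds the first $\lfloor N/2\rfloor$ entries and Bob holds the others. The numbers $N,R$, a window length $K$ and a rank $l$ are known to both in advance. In a deterministic $p$-round protocol, $p$ messages (bit strings) are sent alternately, Alice sending the first one. Before sending a message, and, for the receiver of the last message, at the end, the acting party may append integers to a shared write-only output stream. Messages and outputs depend only on the acting party's own input and on the messages exchanged so far; the parties cannot read the output stream or its current length. Thus the output is written in a single pass. The protocol solves the sliding-window $l$-th smallest element problem if, on every input, the final output stream consists of exactly $N-K+1$ values, the $s$-th of which ($0\le s\le N-K$) is the $l$-th smallest element (counted with multiplicity) of the window $A_s,\dots,A_{s+K-1}$. Its cost is the total number of bits sent in the worst case. **Theorem.** There are absolute constants $C,k$ such that for all integers $l\ge 1$, $p\ge 2l+2$, $N\ge K\ge l$ and $R\ge 0$ there is a $p$-round protocol that solves the sliding-window $l$-th smallest element problem on arrays of length $N$ with entries in $[0,R]$ and window length $K$, at a cost of at most $$C\,p\,l^2\,N^{1/(p-2l-1)}\,\bigl(\log(N+R+2)\bigr)^k$$ bits. That is, $\widetilde O\bigl(p\,l^2N^{1/(p-2l-1)}\bigr)$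 bits suffice, where $\widetilde O$ hides factors polylogarithmic in $N$ and $R$. -/

import Mathlib

namespace SlidingWindow

/-- A deterministic two-party protocol. Alice holds `x : X`, Bob holds `y : Y`. The turns are
numbered `0, 1, 2, …`; Alice acts in the even turns and Bob in the odd ones. In a turn the acting
party appends values to the shared output stream and then sends one message to the other party.
Both actions depend only on the acting party's own input and on the messages exchanged so far
(so neither party can read the output stream, not even the current position in it). The message
sent in turn `t` is a string of exactly `width t` bits, where `width` is fixed in advance. -/
structure Protocol (X Y : Type) where
  /-- The number of bits of the message sent in turn `t`. -/
  width : ℕ → ℕ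
  /-- Alice's next message, given her input and the list of the previous messages. -/
  aliceSend : X → List (List Bool) → List Bool
  /-- Bob's next message, given his input and the list of the previous messages. -/
  bobSend : Y → List (List Bool) → List Bool
  /-- The values that Alice appends to the output, given her input and the previous messages. -/
  aliceOut : X → List (List Bool) → List ℕ
  /-- The values that Bob appends to the output, given his input and the previous messages. -/
  bobOut : Y → List (List Bool) → List ℕ
  aliceSend_length : ∀ x h, (aliceSend x h).length = width h.length
  bobSend_length : ∀ y h, (bobSend y h).length = width h.length

namespace Protocol

variable {X Y : Type}

/-- The list of the first `t` messages on input `(x, y)`, in the order in which they are sent. -/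
def history (P : Protocol X Y) (x : X) (y : Y) : ℕ → List (List Bool)
  | 0 => []
  | t + 1 =>
    P.history x y t ++
      [if Even t then P.aliceSend x (P.history x y t) else P.bobSend y (P.history x y t)]

/-- The contents of the output stream after the `p`-round run on input `(x, y)`: there are `p`
messages, sent in the turns `0, …, p - 1`, and output is produced in the turns `0, …, p`
(in turn `p` the receiver of the last message may still produce output). As values are only ever
appended, this is a single pass over the output stream. -/
def output (P : Protocol X Y) (p : ℕ) (x : X) (y : Y) : List ℕ :=
  (List.range (p + 1)).flatMap fun t =>
    if Even t then P.aliceOut x (P.history x y t) else P.bobOut y (P.history x y t)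

/-- The total number of bits sent in `p` rounds. -/
def cost (P : Protocol X Y) (p : ℕ) : ℕ := ∑ t ∈ Finset.range p, P.width t

end Protocol

/-- An array of `N` integers in `[0, R]`, indexed from `0`. -/
abbrev Arr (N R : ℕ) : Type := Fin N → Fin (R + 1)

/-- The first half of an array of length `N`: the entries with indices `0, …, ⌊N/2⌋ - 1`. -/
def firstHalf {N R : ℕ} (A : Arr N R) : Arr (N / 2) R :=
  fun i => A ⟨i, by omega⟩

/-- The second half of an array of length `N`: the entries with indices `⌊N/2⌋, …, N - 1`. -/
def secondHalf {N R : ℕ} (A : Arr N R) : Arr (N - N / 2) R :=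
  fun i => A ⟨N / 2 + i, by omega⟩

/-- The rank of `A i` in the window `[s, s + K)`: its position, counted from `1`, when the window
is sorted in increasing order and ties are broken by location. -/
def rank {N R : ℕ} (A : Arr N R) (s K : ℕ) (i : Fin N) : ℕ :=
  (Finset.univ.filter fun j : Fin N =>
    (s ≤ (j : ℕ) ∧ (j : ℕ) < s + K) ∧ (A j < A i ∨ (A j = A i ∧ j ≤ i))).card

/-- `v` is the value of the `l`-th smallest element of the window `[s, s + K)`. -/
def IsLthSmallest {N R : ℕ} (A : Arr N R) (s K l v : ℕ) : Prop :=
  ∃ i : Fin N, (s ≤ (i : ℕ) ∧ (i : ℕ) < s + K) ∧ rank A s K i = l ∧ ((A i : ℕ) = v)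

/-- The `p`-round run of `P` solves the sliding-window `l`-th smallest element problem with window
length `K`: on every array, split into halves, it outputs the `l`-th smallest elements of all
`N - K + 1` windows, in the order of the windows. -/
def SolvesLthSmallest {N R : ℕ} (P : Protocol (Arr (N / 2) R) (Arr (N - N / 2) R))
    (p K l : ℕ) : Prop :=
  ∀ A : Arr N R,
    (P.output p (firstHalf A) (secondHalf A)).length = N - K + 1 ∧
    ∀ (s : ℕ) (hs : s < (P.output p (firstHalf A) (secondHalf A)).length),
      IsLthSmallest A s K l ((P.output p (firstHalf A) (secondHalf A))[s])

end SlidingWindow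

namespace SlidingWindow

open Finset

/-! While a window straddles the midpoint, a step to the right only takes elements from Alice and
gives elements to Bob. Her order statistics rise and his fall, so "Bob's `i`-th smallest is at most
Alice's `j`-th" switches once from false to true, at a `threshold` (`kth_le_kth_iff_threshold_le`).

The `l`-th smallest of the union is a party's own order statistic, of a rank determined by how the
two sorted lists interleave. Along the pairs `(i, j) = (1, l), (1, l-1), (2, l-1), …, (l, 1)` the `2
* l - 1` thresholds increase. They cut the windows into `2 * l` possibly empty blocks, owned
alternately by Alice and Bob (`kth_eq_of_mem_block`).

All thresholds are found in parallel by a `B`-ary search in `r` turns, where `B ^ r > N`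
(`exists_search_protocol`). The blocks are then written in consecutive turns, each by its owner, so
a single pass over the output suffices. -/

/-! ### Protocols with typed messages that depend on the last message only -/

section TypedMessages

variable {X Y M : Type}

/-- The last message before turn `t` if each message is determined by the sender's input, the
number of the turn and the message before. -/
def lastMsg (sendA : X → ℕ → Option M → M) (sendB : Y → ℕ → Option M → M) (x : X) (y : Y) :
    ℕ → Option M
  | 0 => none
  | t + 1 => some (if Even t then sendA x t (lastMsg sendA sendB x y t)
      else sendB y t (lastMsg sendA sendB x y t))

theorem exists_encoding [Fintype M] [Nonempty M] {q : ℕ} (hq : Fintype.card M ≤ 2 ^ q) :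
    ∃ (enc : M → List Bool) (dec : List Bool → M),
      (∀ m, (enc m).length = q) ∧ ∀ m, dec (enc m) = m := by
  obtain ⟨e⟩ : Nonempty (M ↪ (Fin q → Bool)) :=
    Function.Embedding.nonempty_of_card_le (by simpa using hq)
  have hinj : Function.Injective fun m => List.ofFn (e m) :=
    List.ofFn_injective.comp e.injective
  exact ⟨fun m => List.ofFn (e m), Function.invFun fun m => List.ofFn (e m), by simp,
    Function.leftInverse_invFun hinj⟩

/-- A finite message type embeds into strings of one fixed width, so a protocol can be designed with
typed messages and no bit-level bookkeeping. -/
theorem exists_protocol_of_lastMsg [Fintype M] [Nonempty M] {q : ℕ}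
    (hq : Fintype.card M ≤ 2 ^ q)
    (sendA : X → ℕ → Option M → M) (sendB : Y → ℕ → Option M → M)
    (outA : X → ℕ → Option M → List ℕ) (outB : Y → ℕ → Option M → List ℕ) :
    ∃ P : Protocol X Y, (∀ p, P.cost p = p * q) ∧ ∀ p x y, P.output p x y =
      (List.range (p + 1)).flatMap fun t =>
        if Even t then outA x t (lastMsg sendA sendB x y t)
        else outB y t (lastMsg sendA sendB x y t) := by
  obtain ⟨enc, dec, hlen, hdec⟩ := exists_encoding hq
  let P : Protocol X Y :=
    { width := fun _ => q
      aliceSend := fun x h => enc (sendA x h.length (h.getLast?.map dec))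
      bobSend := fun y h => enc (sendB y h.length (h.getLast?.map dec))
      aliceOut := fun x h => outA x h.length (h.getLast?.map dec)
      bobOut := fun y h => outB y h.length (h.getLast?.map dec)
      aliceSend_length := fun _ _ => hlen _
      bobSend_length := fun _ _ => hlen _ }
  have hist : ∀ x y t, (P.history x y t).length = t ∧
      (P.history x y t).getLast?.map dec = lastMsg sendA sendB x y t := by
    intro x y t
    induction t with
    | zero => simp [Protocol.history, lastMsg]
    | succ t ih =>
      refine ⟨by simp [Protocol.history, ih.1], ?_⟩
      by_cases ht : Even t <;> simp [Protocol.history, lastMsg, ht, P, hdec] <;>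
        simp [← ih.2, ih.1, P]
  refine ⟨P, fun p => by simp [Protocol.cost, P], fun p x y => ?_⟩
  simp only [Protocol.output]
  congr 1
  funext t
  simp only [P, (hist x y t).1, (hist x y t).2]

end TypedMessages

/-! ### Parallel search for several thresholds -/

section Search

variable {n B S V : ℕ}

/-- A message of the parallel search: lower bounds for the thresholds, and the sender's values at
`B` sample points for each of them. -/
abbrev SearchMsg (n B S V : ℕ) : Type :=
  (Fin n → Fin (S + 1)) × (Fin n → Fin B → Fin (V + 1))

theorem card_searchMsg :
    Fintype.card (SearchMsg n B S V) = (S + 1) ^ n * (V + 1) ^ (n * B) := by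
  simp [pow_mul, pow_right_comm]

/-- The `j`-th sample point above the lower bound `L` at mesh width `W`. -/
def samplePoint (L W j : ℕ) : ℕ := L + (j + 1) * W - 1

/-- The message with lower bounds `L` and the values of `u` at the points of mesh width `W`. -/
def report (B S V : ℕ) (u : Fin n → ℕ → ℕ) (W : ℕ) (L : Fin n → ℕ) : SearchMsg n B S V :=
  (fun m => Fin.ofNat (S + 1) (L m),
    fun m j => Fin.ofNat (V + 1) (u m (samplePoint (L m) W j)))

open Classical in
/-- The lower bounds derived from a message, where `below m s v` says that `s` is below the `m`-th
threshold, `v` being the sender's value at `s`. -/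
noncomputable def refineBounds (below : Fin n → ℕ → ℕ → Prop) (W : ℕ) :
    Option (SearchMsg n B S V) → Fin n → ℕ
  | none => 0
  | some μ => fun m => μ.1 m + W *
      #{j : Fin B | below m (samplePoint (μ.1 m) W j) (μ.2 m j)}

/-- The sample point `L + (j + 1) * W - 1` is below `T` exactly when `L + (j + 1) * W ≤ T`, so
counting such points counts the whole mesh steps from `L` to `T`. The reductions modulo `S + 1` and
`V + 1` are harmless by the bounds on `T` and `u`. -/
theorem refineBounds_report {below : Fin n → ℕ → ℕ → Prop} {W : ℕ} {u : Fin n → ℕ → ℕ}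
    {L T : Fin n → ℕ} (hu : ∀ m s, u m s ≤ V) (hW : 0 < W)
    (hbelow : ∀ m s, below m s (u m s) ↔ s < T m) (hTS : ∀ m, T m ≤ S) (hLT : ∀ m, L m ≤ T m)
    (hT : ∀ m, T m < L m + B * W) (hL : ∀ m, W ∣ L m) :
    refineBounds below W (some (report B S V u W L)) = fun m => T m / W * W := by
  classical
  funext m
  have h1 : (L m) % (S + 1) = L m :=
    Nat.mod_eq_of_lt (Nat.lt_succ_of_le ((hLT m).trans (hTS m)))
  have h2 : ∀ s, u m s % (V + 1) = u m s := fun s => Nat.mod_eq_of_lt (Nat.lt_succ_of_le (hu m s))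
  simp only [refineBounds, report, Fin.val_ofNat, h1, h2, hbelow]
  obtain ⟨c, hc⟩ := hL m
  have hcard : #{j : Fin B | samplePoint (L m) W j < T m} = T m / W - c := by
    have hq : T m / W - c ≤ B := by
      have : T m / W < c + B := by
        rw [Nat.div_lt_iff_lt_mul hW]
        have := hT m
        rw [hc] at this
        linarith
      omega
    have : ∀ j : Fin B, samplePoint (L m) W j < T m ↔ (j : ℕ) < T m / W - c := by
      intro j
      have h3 : c + j + 1 ≤ T m / W ↔ (c + j + 1) * W ≤ T m := Nat.le_div_iff_mul_le hW
      have h4 : L m + (j + 1) * W = (c + j + 1) * W := by rw [hc]; ring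
      have h5 : 0 < (c + j + 1) * W := by positivity
      rw [samplePoint, h4]
      omega
    simp only [this]
    rw [Fin.card_filter_val_lt, min_eq_right hq]
  have hcT : c ≤ T m / W := by
    rw [Nat.le_div_iff_mul_le hW]
    have := hLT m
    rw [hc] at this
    linarith
  rw [hcard, hc, ← mul_add, mul_comm]
  congr 1
  omega

/-- If `b y m s ≤ a x m s` just says that `s` is at least the threshold `T x y m`, then both
parties can find the thresholds by a `B`-ary search in `r` turns. -/
theorem exists_search_protocol {X Y : Type} {r q : ℕ} (hq : (S + 1) ^ n * (V + 1) ^ (n * B) ≤ 2 ^ q)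
    (hS : S < B ^ r) (hB : 0 < B) (a : X → Fin n → ℕ → ℕ) (b : Y → Fin n → ℕ → ℕ)
    (ha : ∀ x m s, a x m s ≤ V) (hb : ∀ y m s, b y m s ≤ V) (T : X → Y → Fin n → ℕ)
    (hT : ∀ x y m s, b y m s ≤ a x m s ↔ T x y m ≤ s) (hTS : ∀ x y m, T x y m ≤ S)
    (outA : X → ℕ → (Fin n → ℕ) → List ℕ) (outB : Y → ℕ → (Fin n → ℕ) → List ℕ) :
    ∃ P : Protocol X Y, (∀ p, P.cost p = p * q) ∧ ∀ p x y, P.output p x y =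
      (List.range (p + 1)).flatMap fun t =>
        if Even t then outA x t fun m => T x y m / B ^ (r - t) * B ^ (r - t)
        else outB y t fun m => T x y m / B ^ (r - t) * B ^ (r - t) := by
  let lowA (x : X) (t : ℕ) (μ : Option (SearchMsg n B S V)) : Fin n → ℕ :=
    refineBounds (fun m s v => a x m s < v) (B ^ (r - t)) μ
  let lowB (y : Y) (t : ℕ) (μ : Option (SearchMsg n B S V)) : Fin n → ℕ :=
    refineBounds (fun m s v => v < b y m s) (B ^ (r - t)) μ
  let sendA (x : X) (t : ℕ) (μ : Option (SearchMsg n B S V)) : SearchMsg n B S V :=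
    report B S V (a x) (B ^ (r - (t + 1))) (lowA x t μ)
  let sendB (y : Y) (t : ℕ) (μ : Option (SearchMsg n B S V)) : SearchMsg n B S V :=
    report B S V (b y) (B ^ (r - (t + 1))) (lowB y t μ)
  have : Nonempty (SearchMsg n B S V) := by
    cases B with
    | zero => omega
    | succ B => exact ⟨(fun _ => 0, fun _ _ => 0)⟩
  obtain ⟨P, hP, hout⟩ := exists_protocol_of_lastMsg (card_searchMsg.trans_le hq) sendA sendB
    (fun x t μ => outA x t (lowA x t μ)) (fun y t μ => outB y t (lowB y t μ))
  refine ⟨P, hP, fun p x y => ?_⟩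
  -- Invariant: whoever acts in turn `t` knows every threshold rounded down to a multiple of `B ^ (r
  -- - t)`. By truncated subtraction the mesh stays 1 from turn `r` on, so later messages relay the
  -- exact thresholds.
  have key : ∀ t,
      (Even t → lowA x t (lastMsg sendA sendB x y t) =
        fun m => T x y m / B ^ (r - t) * B ^ (r - t)) ∧
      (¬ Even t → lowB y t (lastMsg sendA sendB x y t) =
        fun m => T x y m / B ^ (r - t) * B ^ (r - t)) := by
    intro t
    induction t with
    | zero =>
      refine ⟨fun _ => ?_, fun h => absurd Even.zero h⟩
      funext m
      simp [lowA, lastMsg, refineBounds, Nat.div_eq_of_lt ((hTS x y m).trans_lt hS)]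
    | succ t ih =>
      have hpow : B ^ (r - t) ≤ B * B ^ (r - (t + 1)) := by
        rw [← pow_succ']
        exact Nat.pow_le_pow_right hB (by omega)
      have hlt : ∀ m, T x y m <
          T x y m / B ^ (r - t) * B ^ (r - t) + B * B ^ (r - (t + 1)) := fun m =>
        (Nat.lt_div_mul_add (pow_pos hB _)).trans_le (Nat.add_le_add_left hpow _)
      have hdvd : ∀ m, B ^ (r - (t + 1)) ∣ T x y m / B ^ (r - t) * B ^ (r - t) := fun m =>
        Dvd.dvd.mul_left (pow_dvd_pow _ (by omega)) _
      refine ⟨fun h => ?_, fun h => ?_⟩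
      · have ht : ¬ Even t := by rwa [Nat.even_add_one] at h
        simp only [lastMsg, if_neg ht, sendB, ih.2 ht, lowA]
        exact refineBounds_report (hb y) (pow_pos hB _) (fun m s => by rw [← not_le, hT, not_le])
          (hTS x y) (fun m => Nat.div_mul_le_self _ _) hlt hdvd
      · have ht : Even t := by rwa [Nat.even_add_one, not_not] at h
        simp only [lastMsg, if_pos ht, sendA, ih.1 ht, lowB]
        exact refineBounds_report (ha x) (pow_pos hB _) (fun m s => by rw [← not_le, hT, not_le])
          (hTS x y) (fun m => Nat.div_mul_le_self _ _) hlt hdvd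
  rw [hout]
  congr 1
  funext t
  by_cases ht : Even t
  · simp only [if_pos ht, (key t).1 ht]
  · simp only [if_neg ht, (key t).2 ht]

end Search

/-! ### Order statistics from counting functions -/

section Kth

variable {R : ℕ} {c d : ℕ → ℕ}

/-- The least value `v` with `j ≤ c v`, or `R + 1` if no `v ≤ R` has this property. If `c v` counts
the elements that are at most `v`, this is the `j`-th smallest element. -/
noncomputable def kth (R : ℕ) (c : ℕ → ℕ) (j : ℕ) : ℕ := sInf {v | R < v ∨ j ≤ c v}

theorem kth_le_iff (hc : Monotone c) {j v : ℕ} : kth R c j ≤ v ↔ R < v ∨ j ≤ c v := by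
  refine ⟨fun h => ?_, fun h => Nat.sInf_le h⟩
  have hmem : R < kth R c j ∨ j ≤ c (kth R c j) :=
    Nat.sInf_mem (s := {v | R < v ∨ j ≤ c v}) ⟨R + 1, Or.inl (Nat.lt_succ_self R)⟩
  exact hmem.imp (fun h' => h'.trans_le h) fun h' => h'.trans (hc h)

theorem lt_kth_iff (hc : Monotone c) {j v : ℕ} : v < kth R c j ↔ v ≤ R ∧ c v < j := by
  rw [← not_le, kth_le_iff hc]
  push Not
  rfl

theorem kth_le_succ (R : ℕ) (c : ℕ → ℕ) (j : ℕ) : kth R c j ≤ R + 1 :=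
  Nat.sInf_le (Or.inl (Nat.lt_succ_self R))

theorem kth_mono (hc : Monotone c) (hd : Monotone d) {i j : ℕ} (hij : i ≤ j)
    (h : ∀ v, d v ≤ c v) : kth R c i ≤ kth R d j := by
  rw [kth_le_iff hc]
  exact ((kth_le_iff hd).1 le_rfl).imp_right fun h' => (hij.trans h').trans (h _)

/-- At the value `kth R c j` there are at least `j` elements from `c` and exactly `i` from `d`; at
any smaller value, fewer than `j` and at most `i`. The strict bound also excludes the sentinel `R +
1`. -/
theorem kth_add_eq_left (hc : Monotone c) (hd : Monotone d) {i j : ℕ}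
    (h₁ : kth R d i ≤ kth R c j) (h₂ : kth R c j < kth R d (i + 1)) :
    kth R (c + d) (j + i) = kth R c j := by
  have h3 := (lt_kth_iff hd).1 h₂
  have h4 := (kth_le_iff hd).1 h₁
  have h5 := (kth_le_iff hc).1 (le_refl (kth R c j))
  apply le_antisymm
  · refine Nat.sInf_le ?_
    rw [Set.mem_ofPred_eq, Pi.add_apply]
    omega
  · by_contra! h
    have h6 := (lt_kth_iff hc).1 h
    have h7 := (kth_le_iff (hc.add hd)).1 (le_refl (kth R (c + d) (j + i)))
    have h8 := hd h.le
    omega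

/-- Both bounds are weak here, so `hR` is what excludes the sentinel `R + 1`. -/
theorem kth_add_eq_right (hc : Monotone c) (hd : Monotone d) {i j : ℕ}
    (h₁ : kth R c j ≤ kth R d (i + 1)) (h₂ : kth R d (i + 1) ≤ kth R c (j + 1))
    (hR : j + i + 1 ≤ c R + d R) : kth R (c + d) (j + i + 1) = kth R d (i + 1) := by
  have h3 : kth R d (i + 1) ≤ R := by
    by_contra! h
    have := (lt_kth_iff hd).1 h
    have := (lt_kth_iff hc).1 (h.trans_le h₂)
    omega
  have h4 := (kth_le_iff hc).1 h₁
  have h5 := (kth_le_iff hd).1 (le_refl (kth R d (i + 1)))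
  apply le_antisymm
  · refine Nat.sInf_le ?_
    rw [Set.mem_ofPred_eq, Pi.add_apply]
    omega
  · by_contra! h
    have h6 := (lt_kth_iff hd).1 h
    have h7 := (lt_kth_iff hc).1 (h.trans_le h₂)
    have h8 := (kth_le_iff (hc.add hd)).1 (le_refl (kth R (c + d) (j + i + 1)))
    omega

end Kth

/-! ### Counting in windows -/

section Windows

variable {n N R K : ℕ}

/-- The number of elements `≤ v` in the window `[s, s + K)`, where the entries of `x` have the
locations `off, off + 1, …`. -/
def windowCount (K off : ℕ) (x : Arr n R) (s v : ℕ) : ℕ :=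
  #{j : Fin n | (s ≤ off + j ∧ off + j < s + K) ∧ (x j : ℕ) ≤ v}

theorem windowCount_mono (K off : ℕ) (x : Arr n R) (s : ℕ) : Monotone (windowCount K off x s) :=
  fun _ _ h => card_le_card (monotone_filter_right _ fun _ _ h' => ⟨h'.1, h'.2.trans h⟩)

theorem windowCount_le_of_imp {K off s s' : ℕ} (x : Arr n R)
    (h : ∀ j < n, s ≤ off + j ∧ off + j < s + K → s' ≤ off + j ∧ off + j < s' + K) (v : ℕ) :
    windowCount K off x s v ≤ windowCount K off x s' v :=
  card_le_card (monotone_filter_right _ fun j _ h' => ⟨h j j.2 h'.1, h'.2⟩)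

theorem windowCount_eq_zero {K off s : ℕ} (x : Arr n R)
    (h : ∀ j < n, ¬ (s ≤ off + j ∧ off + j < s + K)) (v : ℕ) : windowCount K off x s v = 0 := by
  rw [windowCount, card_eq_zero, filter_eq_empty_iff]
  exact fun j _ h' => h j j.2 h'.1

theorem windowCount_full {s : ℕ} (x : Arr n R) (h : s + K ≤ n) : windowCount K 0 x s R = K := by
  have : (univ.filter fun j : Fin n => (s ≤ 0 + (j : ℕ) ∧ 0 + (j : ℕ) < s + K) ∧ (x j : ℕ) ≤ R) =
      (Finset.Ico s (s + K)).attachFin (fun m hm => by rw [Finset.mem_Ico] at hm; omega) := by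
    ext j
    have := (x j).2
    simp only [mem_filter, mem_univ, true_and, mem_attachFin, Finset.mem_Ico, zero_add]
    constructor
    · exact fun h => h.1
    · exact fun h => ⟨h, by omega⟩
  rw [windowCount, this, card_attachFin]
  simp

theorem windowCount_halves (A : Arr N R) (s : ℕ) :
    windowCount K 0 (firstHalf A) s + windowCount K (N / 2) (secondHalf A) s =
      windowCount K 0 A s := by
  funext v
  have hN : N / 2 + (N - N / 2) = N := by omega
  simp only [Pi.add_apply, windowCount, card_filter]
  rw [← (finCongr hN).sum_comp, Fin.sum_univ_add]
  simp [firstHalf, secondHalf, Fin.castAdd, Fin.natAdd, Fin.castLE, -sum_boole]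
  congr!

theorem exists_card_filter_le_eq {α : Type*} [LinearOrder α] (S : Finset α) :
    ∀ k, 1 ≤ k → k ≤ #S → ∃ i ∈ S, #{j ∈ S | j ≤ i} = k := by
  induction S using Finset.induction_on_max with
  | empty => intro k h1 h2; simp at h2; omega
  | insert a S hlt ih =>
    intro k h1 h2
    have ha : a ∉ S := fun h => lt_irrefl _ (hlt a h)
    rw [card_insert_of_notMem ha] at h2
    rcases Nat.lt_or_ge #S k with h | h
    · refine ⟨a, mem_insert_self _ _, ?_⟩
      rw [filter_true_of_mem, card_insert_of_notMem ha]
      · omega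
      · intro j hj
        rcases mem_insert.1 hj with rfl | hj
        exacts [le_rfl, (hlt j hj).le]
    · obtain ⟨i, hi, hk⟩ := ih k h1 h
      refine ⟨i, mem_insert_of_mem hi, ?_⟩
      rwa [filter_insert, if_neg (not_le.2 (hlt i hi))]

theorem isLthSmallest_kth (A : Arr N R) {s l : ℕ} (hl : 1 ≤ l) (h : l ≤ windowCount K 0 A s R) :
    IsLthSmallest A s K l (kth R (windowCount K 0 A s) l) := by
  have hmono := windowCount_mono K 0 A s
  set v := kth R (windowCount K 0 A s) l with hv
  have hvR : v ≤ R := (kth_le_iff hmono).2 (Or.inr h)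
  have hle : l ≤ windowCount K 0 A s v :=
    ((kth_le_iff hmono).1 hv.ge).resolve_left (by omega)
  let Lo : Finset (Fin N) := {j | (s ≤ (j : ℕ) ∧ (j : ℕ) < s + K) ∧ (A j : ℕ) < v}
  let Eq : Finset (Fin N) := {j | (s ≤ (j : ℕ) ∧ (j : ℕ) < s + K) ∧ (A j : ℕ) = v}
  have hLo : #Lo < l := by
    rcases Nat.eq_zero_or_pos v with h0 | h0
    · have : Lo = ∅ := by simp [Lo, h0]
      rw [this]; simpa using Nat.lt_of_succ_le hl
    · have h1 : v - 1 < kth R (windowCount K 0 A s) l := by omega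
      refine lt_of_eq_of_lt ?_ ((lt_kth_iff hmono).1 h1).2
      rw [windowCount]
      congr 1
      ext j
      simp only [Lo, mem_filter, mem_univ, true_and, zero_add]
      omega
  have hsum : windowCount K 0 A s v = #Lo + #Eq := by
    rw [← card_union_of_disjoint, windowCount]
    · congr 1
      ext j
      simp only [Lo, Eq, mem_filter, mem_univ, true_and, zero_add, mem_union]
      omega
    · rw [disjoint_left]
      intro j
      simp only [Lo, Eq, mem_filter, mem_univ, true_and]
      omega
  -- Ties are broken by location: the witness is the `(l - #Lo)`-th location among those of value
  -- `v`.
  obtain ⟨i, hi, hcard⟩ := exists_card_filter_le_eq Eq (l - #Lo) (by omega) (by omega)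
  have hi' : (s ≤ (i : ℕ) ∧ (i : ℕ) < s + K) ∧ (A i : ℕ) = v := by simpa [Eq] using hi
  refine ⟨i, hi'.1, ?_, hi'.2⟩
  have : rank A s K i = #Lo + #{j ∈ Eq | j ≤ i} := by
    rw [← card_union_of_disjoint, rank]
    · congr 1
      ext j
      simp only [Lo, Eq, mem_filter, mem_univ, true_and, mem_union, Fin.lt_def, Fin.ext_iff, hi'.2]
      tauto
    · rw [disjoint_left]
      intro j
      simp only [Lo, Eq, mem_filter, mem_univ, true_and]
      omega
  omega

end Windows

/-! ### The thresholds at which the owner of the answer changes -/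

section Thresholds

variable {n n' R K : ℕ}

/-- The first window in which the `i`-th smallest of Bob's elements is at most the `j`-th smallest
of Alice's. -/
noncomputable def threshold (K : ℕ) (x : Arr n R) (y : Arr n' R) (i j : ℕ) : ℕ :=
  sInf {s | kth R (windowCount K n y s) i ≤ kth R (windowCount K 0 x s) j}

theorem kth_le_kth_of_le (x : Arr n R) (y : Arr n' R) {i j s : ℕ} (hj : 1 ≤ j) (hs : n ≤ s) :
    kth R (windowCount K n y s) i ≤ kth R (windowCount K 0 x s) j := by
  refine (kth_le_succ _ _ _).trans (Nat.succ_le_of_lt ((lt_kth_iff (windowCount_mono ..)).2 ?_))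
  rw [windowCount_eq_zero x (fun j hj h => by omega)]
  exact ⟨le_rfl, hj⟩

theorem threshold_le (x : Arr n R) (y : Arr n' R) {i j : ℕ} (hj : 1 ≤ j) :
    threshold K x y i j ≤ n :=
  Nat.sInf_le (kth_le_kth_of_le x y hj le_rfl)

/-- Only straddling windows need the monotonicity of both sides. In a window wholly inside Alice's
half, Bob's side is `R + 1` and hers is at most `R`, so the premise fails; once the window has left
her half, her side is `R + 1`. -/
theorem kth_le_kth_succ (x : Arr n R) (y : Arr n' R) {i j s : ℕ} (hi : 1 ≤ i) (hj : 1 ≤ j)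
    (hjK : j ≤ K) (h : kth R (windowCount K n y s) i ≤ kth R (windowCount K 0 x s) j) :
    kth R (windowCount K n y (s + 1)) i ≤ kth R (windowCount K 0 x (s + 1)) j := by
  rcases Nat.lt_or_ge s n with hs | hs
  · rcases Nat.lt_or_ge n (s + K) with hK | hK
    · refine le_trans ?_ (h.trans ?_)
      · exact kth_mono (windowCount_mono ..) (windowCount_mono ..) le_rfl
          (windowCount_le_of_imp y fun k hk h => by omega)
      · exact kth_mono (windowCount_mono ..) (windowCount_mono ..) le_rfl
          (windowCount_le_of_imp x fun k hk h => by omega)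
    · exfalso
      have h1 : R < kth R (windowCount K n y s) i := by
        rw [lt_kth_iff (windowCount_mono ..), windowCount_eq_zero y (fun j hj h => by omega)]
        exact ⟨le_rfl, hi⟩
      have h2 : kth R (windowCount K 0 x s) j ≤ R := by
        rw [kth_le_iff (windowCount_mono ..), windowCount_full x hK]
        exact Or.inr hjK
      omega
  · exact kth_le_kth_of_le x y hj (by omega)

theorem kth_le_kth_iff_threshold_le (x : Arr n R) (y : Arr n' R) {i j : ℕ} (hi : 1 ≤ i)
    (hj : 1 ≤ j) (hjK : j ≤ K) (s : ℕ) :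
    kth R (windowCount K n y s) i ≤ kth R (windowCount K 0 x s) j ↔ threshold K x y i j ≤ s := by
  refine ⟨fun h => Nat.sInf_le h, fun h => ?_⟩
  induction s, h using Nat.le_induction with
  | base => exact Nat.sInf_mem (s := {s | kth R (windowCount K n y s) i ≤
      kth R (windowCount K 0 x s) j}) ⟨n, kth_le_kth_of_le x y hj le_rfl⟩
  | succ s _ ih => exact kth_le_kth_succ x y hi hj hjK ih

end Thresholds

/-! ### Blocks of output -/

section Blocks

/-- The start of the `m`-th block of output, given the thresholds `θ` and the number `M` of all
windows. -/
def blockStart {n : ℕ} (θ : Fin n → ℕ) (M : ℕ) : ℕ → ℕ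
  | 0 => 0
  | m + 1 => if h : m < n then min (θ ⟨m, h⟩) M else M

theorem flatMap_range_blocks (E : ℕ → ℕ) (hE : Monotone E) (g : ℕ → ℕ) (n : ℕ) :
    (List.range n).flatMap (fun m => (List.Ico (E m) (E (m + 1))).map g) =
      (List.Ico (E 0) (E n)).map g := by
  induction n with
  | zero => simp
  | succ n ih =>
    rw [List.range_succ, List.flatMap_append, ih, List.flatMap_singleton, ← List.map_append,
      List.Ico.append_consecutive (hE (Nat.zero_le n)) (hE n.le_succ)]

theorem flatMap_range_shift (f : ℕ → List ℕ) (a n : ℕ) (hf : ∀ t < a, f t = []) :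
    (List.range (a + n)).flatMap f = (List.range n).flatMap fun m => f (a + m) := by
  rw [List.range_add, List.flatMap_append, List.flatMap_map]
  rw [List.flatMap_eq_nil_iff.2 fun t ht => hf t (List.mem_range.1 ht), List.nil_append]

variable {N R K l : ℕ}

/-- The list of thresholds between the `2 l` blocks. -/
noncomputable def thresholds {n n' : ℕ} (l K : ℕ) (x : Arr n R) (y : Arr n' R)
    (m : Fin (2 * l - 1)) : ℕ :=
  threshold K x y (m / 2 + 1) (l - (m + 1) / 2)

/-- A larger index means a higher rank for Bob and a lower one for Alice, which makes the defining
inequality harder to satisfy. -/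
theorem thresholds_mono {n n' : ℕ} (hlK : l ≤ K) (x : Arr n R) (y : Arr n' R)
    {m m' : Fin (2 * l - 1)} (h : m ≤ m') : thresholds l K x y m ≤ thresholds l K x y m' := by
  have hm := m.2
  have hm' := m'.2
  have h' : (m : ℕ) ≤ m' := h
  rw [thresholds, thresholds, ← kth_le_kth_iff_threshold_le x y (by omega) (by omega) (by omega)]
  have := (kth_le_kth_iff_threshold_le x y (K := K) (i := m' / 2 + 1) (j := l - (m' + 1) / 2)
    (by omega) (by omega) (by omega) (threshold K x y (m' / 2 + 1) (l - (m' + 1) / 2))).2 le_rfl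
  exact (kth_mono (windowCount_mono ..) (windowCount_mono ..) (by omega) fun _ => le_rfl).trans
    (this.trans
      (kth_mono (windowCount_mono ..) (windowCount_mono ..) (by omega) fun _ => le_rfl))

theorem blockStart_mono {n : ℕ} {θ : Fin n → ℕ} (hθ : Monotone θ) (M : ℕ) :
    Monotone (blockStart θ M) := by
  refine monotone_nat_of_le_succ fun m => ?_
  cases m with
  | zero => exact Nat.zero_le _
  | succ m =>
    simp only [blockStart]
    split_ifs
    · exact min_le_min_right _ (hθ (by simp))
    · exact min_le_right _ _
    · omega
    · exact le_rfl

theorem kth_eq_of_mem_block (A : Arr N R) (hlK : l ≤ K) (hKN : K ≤ N) {m s : ℕ} (hm : m < 2 * l)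
    (hs : s ∈ List.Ico
      (blockStart (thresholds l K (firstHalf A) (secondHalf A)) (N - K + 1) m)
      (blockStart (thresholds l K (firstHalf A) (secondHalf A)) (N - K + 1) (m + 1))) :
    kth R (windowCount K 0 A s) l =
      if Even m then kth R (windowCount K 0 (firstHalf A) s) (l - m / 2)
      else kth R (windowCount K (N / 2) (secondHalf A) s) (m / 2 + 1) := by
  rw [List.Ico.mem] at hs
  set x := firstHalf A with hx
  set y := secondHalf A with hy
  have hsM : s < N - K + 1 := by
    refine hs.2.trans_le ?_
    simp only [blockStart]
    split_ifs
    exacts [min_le_right _ _, le_rfl]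
  have hlow : ∀ k (hk : k < 2 * l - 1), m = k + 1 →
      kth R (windowCount K (N / 2) y s) (k / 2 + 1) ≤
        kth R (windowCount K 0 x s) (l - (k + 1) / 2) := by
    rintro k hk rfl
    rw [kth_le_kth_iff_threshold_le x y (by omega) (by omega) (by omega)]
    have := hs.1
    simp only [blockStart, dif_pos hk, thresholds] at this
    omega
  have hupp : ∀ hk : m < 2 * l - 1,
      kth R (windowCount K 0 x s) (l - (m + 1) / 2) <
        kth R (windowCount K (N / 2) y s) (m / 2 + 1) := by
    intro hk
    rw [← not_le, kth_le_kth_iff_threshold_le x y (by omega) (by omega) (by omega)]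
    have := hs.2
    simp only [blockStart, dif_pos hk, thresholds] at this
    omega
  have hc := windowCount_mono K 0 x s
  have hd := windowCount_mono K (N / 2) y s
  -- Rank 0 supplies the interleaving inequality for which the first and the last block have no
  -- threshold.
  have hzero : ∀ c : ℕ → ℕ, kth R c 0 = 0 := fun c =>
    Nat.le_zero.1 (Nat.sInf_le (Or.inr (Nat.zero_le _)))
  have hsum := windowCount_halves (K := K) A s
  rw [← hx, ← hy] at hsum
  have hfull : windowCount K 0 x s R + windowCount K (N / 2) y s R = K := by
    rw [← Pi.add_apply (windowCount K 0 x s), hsum]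
    exact windowCount_full A (by omega)
  rw [← hsum]
  obtain ⟨i, hi | hi⟩ := Nat.even_or_odd' m
  · subst hi
    rw [if_pos (even_two_mul i)]
    have h2 := hupp (by omega)
    rw [show (2 * i + 1) / 2 = i by omega, show 2 * i / 2 = i by omega] at h2
    rw [show 2 * i / 2 = i by omega]
    have := kth_add_eq_left (R := R) hc hd (i := i) (j := l - i) ?_ h2
    · rwa [show l - i + i = l by omega] at this
    · cases i with
      | zero => rw [hzero]; exact Nat.zero_le _
      | succ i =>
        have h1 := hlow (2 * i + 1) (by omega) (by omega)
        rwa [show (2 * i + 1) / 2 = i by omega, show (2 * i + 1 + 1) / 2 = i + 1 by omega] at h1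
  · subst hi
    rw [if_neg (by simp)]
    have h1 := hlow (2 * i) (by omega) rfl
    rw [show (2 * i + 1) / 2 = i by omega, show 2 * i / 2 = i by omega] at h1
    rw [show (2 * i + 1) / 2 = i by omega]
    have := kth_add_eq_right (R := R) hc hd (i := i) (j := l - (i + 1)) ?_ ?_ (by omega)
    · rwa [show l - (i + 1) + i + 1 = l by omega] at this
    · rcases Nat.eq_zero_or_pos (l - (i + 1)) with h0 | h0
      · rw [h0, hzero]; exact Nat.zero_le _
      · have h2 := hupp (by omega)
        rw [show (2 * i + 1) / 2 = i by omega, show (2 * i + 1 + 1) / 2 = i + 1 by omega] at h2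
        exact h2.le
    · rwa [show l - (i + 1) + 1 = l - i by omega]

theorem solvesLthSmallest_of_output_eq {P : Protocol (Arr (N / 2) R) (Arr (N - N / 2) R)} {p : ℕ}
    (hl : 1 ≤ l) (hlK : l ≤ K) (hKN : K ≤ N)
    (h : ∀ A : Arr N R, P.output p (firstHalf A) (secondHalf A) =
      (List.range (N - K + 1)).map fun s => kth R (windowCount K 0 A s) l) :
    SolvesLthSmallest P p K l := by
  intro A
  rw [h A]
  refine ⟨by simp, fun s hs => ?_⟩
  rw [List.getElem_map, List.getElem_range]
  rw [List.length_map, List.length_range] at hs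
  apply isLthSmallest_kth A hl
  rw [windowCount_full A (by omega)]
  exact hlK

theorem exists_protocol_solvesLthSmallest {r p B q : ℕ} (hl : 1 ≤ l) (hlK : l ≤ K) (hKN : K ≤ N)
    (hB : 0 < B) (hNB : N < B ^ r) (hp : r + 2 * l ≤ p)
    (hq : (N + 1) ^ (2 * l - 1) * (R + 2) ^ ((2 * l - 1) * B) ≤ 2 ^ q) :
    ∃ P : Protocol (Arr (N / 2) R) (Arr (N - N / 2) R),
      SolvesLthSmallest P p K l ∧ P.cost p = p * q := by
  -- Block 0 is Alice's, so output must start in an even turn; this delays it by at most one turn,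
  -- and the last block is written by turn `r + 2 * l`.
  obtain ⟨t₀, ht₀, hrt₀, ht₀r⟩ : ∃ t₀, Even t₀ ∧ r ≤ t₀ ∧ t₀ ≤ r + 1 := by
    by_cases h : Even r
    · exact ⟨r, h, le_rfl, by omega⟩
    · exact ⟨r + 1, by rwa [Nat.even_add_one], by omega, le_rfl⟩
  obtain ⟨P, hcost, hout⟩ := exists_search_protocol (n := 2 * l - 1) (S := N) (V := R + 1) hq hNB hB
    (fun (x : Arr (N / 2) R) m s => kth R (windowCount K 0 x s) (l - (m + 1) / 2))
    (fun (y : Arr (N - N / 2) R) m s => kth R (windowCount K (N / 2) y s) (m / 2 + 1))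
    (fun _ _ _ => kth_le_succ _ _ _) (fun _ _ _ => kth_le_succ _ _ _) (thresholds l K)
    (fun x y m s => kth_le_kth_iff_threshold_le x y (by omega) (by omega) (by omega) s)
    (fun x y m => (threshold_le x y (by omega)).trans (Nat.div_le_self _ _))
    (fun x t θ => if t₀ ≤ t then
        (List.Ico (blockStart θ (N - K + 1) (t - t₀)) (blockStart θ (N - K + 1) (t - t₀ + 1))).map
          fun s => kth R (windowCount K 0 x s) (l - (t - t₀) / 2)
      else [])
    (fun y t θ => if t₀ ≤ t then
        (List.Ico (blockStart θ (N - K + 1) (t - t₀)) (blockStart θ (N - K + 1) (t - t₀ + 1))).map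
          fun s => kth R (windowCount K (N / 2) y s) ((t - t₀) / 2 + 1)
      else [])
  refine ⟨P, solvesLthSmallest_of_output_eq hl hlK hKN fun A => ?_, hcost p⟩
  set θ := thresholds l K (firstHalf A) (secondHalf A)
  have hmono : Monotone (blockStart θ (N - K + 1)) :=
    blockStart_mono (fun _ _ h => thresholds_mono hlK _ _ h) _
  have hlast : ∀ m, 2 * l ≤ m → blockStart θ (N - K + 1) m = N - K + 1 := by
    rintro (_ | m) hm
    · omega
    · rw [blockStart, dif_neg (by omega)]
  rw [hout, show p + 1 = t₀ + (p + 1 - t₀) by omega, flatMap_range_shift]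
  · have hblocks := flatMap_range_blocks (blockStart θ (N - K + 1)) hmono
      (fun s => kth R (windowCount K 0 A s) l) (p + 1 - t₀)
    rw [hlast (p + 1 - t₀) (by omega), blockStart, List.Ico.zero_bot] at hblocks
    rw [← hblocks]
    congr 1
    funext m
    have hr : r - (t₀ + m) = 0 := by omega
    simp only [hr, pow_zero, Nat.div_one, mul_one, Nat.le_add_right, if_true,
      Nat.add_sub_cancel_left, Nat.even_add, ht₀, true_iff]
    change (if Even m then (List.Ico (blockStart θ _ _) (blockStart θ _ _)).map _
      else (List.Ico (blockStart θ _ _) (blockStart θ _ _)).map _) = _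
    rcases Nat.lt_or_ge m (2 * l) with hm | hm
    · split_ifs with he <;> refine List.map_congr_left fun s hs => ?_ <;>
        simp [kth_eq_of_mem_block A hlK hKN hm hs, he]
    · simp [hlast m hm, hlast (m + 1) (by omega)]
  · intro t ht
    simp [Nat.not_le.2 ht]

end Blocks

/-! ### The cost -/

section Cost

theorem exists_branching (N r : ℕ) (hN : 1 ≤ N) (hr : 1 ≤ r) :
    ∃ B : ℕ, 0 < B ∧ N < B ^ r ∧ (B : ℝ) ≤ 3 * (N : ℝ) ^ (1 / (r : ℝ)) := by
  have hN' : (1 : ℝ) ≤ N := by exact_mod_cast hN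
  set z : ℝ := (N : ℝ) ^ (1 / (r : ℝ)) with hz
  have hz1 : 1 ≤ z := Real.one_le_rpow hN' (by positivity)
  have hzr : z ^ r = N := by
    rw [hz, one_div, Real.rpow_inv_natCast_pow (by positivity) (by omega)]
  refine ⟨⌊z⌋₊ + 1, Nat.succ_pos _, ?_, ?_⟩
  · have : (N : ℝ) < ((⌊z⌋₊ + 1 : ℕ) : ℝ) ^ r := by
      rw [← hzr]
      push_cast
      exact pow_lt_pow_left₀ (Nat.lt_floor_add_one z) (by positivity) (by omega)
    exact_mod_cast this
  · push_cast
    have := Nat.floor_le (zero_le_one.trans hz1)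
    linarith

theorem clog_two_le (D : ℕ) (hD : 2 ≤ D) : (Nat.clog 2 D : ℝ) ≤ 3 * Real.log D := by
  have h1 : Nat.clog 2 D ≤ Nat.log 2 D + 1 := by
    rw [Nat.clog_le_iff_le_pow (by norm_num)]
    exact (Nat.lt_pow_succ_log_self (by norm_num) D).le
  have h2 : (Nat.log 2 D : ℝ) * Real.log 2 ≤ Real.log D := by
    rw [← Real.log_pow]
    apply Real.log_le_log (by positivity)
    exact_mod_cast Nat.pow_log_le_self 2 (by omega)
  have h3 : Real.log 2 ≤ Real.log D := Real.log_le_log (by norm_num) (by exact_mod_cast hD)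
  -- The constant 3 works because `2 / log 2 < 3`.
  have h4 := Real.log_two_gt_d9
  have h5 : (Nat.clog 2 D : ℝ) ≤ Nat.log 2 D + 1 := by exact_mod_cast h1
  have h6 : (0 : ℝ) ≤ Nat.log 2 D := Nat.cast_nonneg _
  nlinarith

end Cost

end SlidingWindow

theorem mainTheorem4 :
    ∃ (C : ℝ) (k : ℕ), ∀ l p N K R : ℕ, 1 ≤ l → 2 * l + 2 ≤ p → l ≤ K → K ≤ N →
      ∃ P : SlidingWindow.Protocol (SlidingWindow.Arr (N / 2) R)
          (SlidingWindow.Arr (N - N / 2) R),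
        SlidingWindow.SolvesLthSmallest P p K l ∧
        (P.cost p : ℝ) ≤
          C * ((p : ℝ) * (l : ℝ) ^ 2 * (N : ℝ) ^ (1 / ((p : ℝ) - 2 * (l : ℝ) - 1))) *
            Real.log ((N : ℝ) + (R : ℝ) + 2) ^ k := by
  -- `24 = 3 * 2 * 4`, from `c ≤ 3 * log`, `2 * l - 1 ≤ 2 * l ^ 2` and `B + 1 ≤ 4 * z`. The middle
  -- estimate is generous: the construction is only linear in `l`.
  refine ⟨24, 1, fun l p N K R hl hp hlK hKN => ?_⟩
  -- This leaves `r ≥ 1` search turns and one round more than the `r + 2 * l` that the protocol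
  -- needs.
  obtain ⟨r, rfl⟩ : ∃ r, p = r + 2 * l + 1 := ⟨p - 2 * l - 1, by omega⟩
  obtain ⟨B, hB, hNB, hBz⟩ := SlidingWindow.exists_branching N r (by omega) (by omega)
  have hc := SlidingWindow.clog_two_le (N + R + 2) (by omega)
  set c := Nat.clog 2 (N + R + 2)
  have hD : N + R + 2 ≤ 2 ^ c := Nat.le_pow_clog (by norm_num) _
  have hq : (N + 1) ^ (2 * l - 1) * (R + 2) ^ ((2 * l - 1) * B) ≤
      2 ^ (c * ((2 * l - 1) * (B + 1))) := by
    calc (N + 1) ^ (2 * l - 1) * (R + 2) ^ ((2 * l - 1) * B)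
        ≤ (2 ^ c) ^ (2 * l - 1) * (2 ^ c) ^ ((2 * l - 1) * B) :=
          Nat.mul_le_mul (Nat.pow_le_pow_left (by omega) _) (Nat.pow_le_pow_left (by omega) _)
      _ = _ := by rw [← pow_add, ← pow_mul]; ring_nf
  obtain ⟨P, hP, hcost⟩ := SlidingWindow.exists_protocol_solvesLthSmallest
    (p := r + 2 * l + 1) hl hlK hKN hB hNB (by omega) hq
  refine ⟨P, hP, ?_⟩
  have hexp : ((r + 2 * l + 1 : ℕ) : ℝ) - 2 * (l : ℝ) - 1 = r := by push_cast; ring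
  rw [hcost, hexp, pow_one]
  set z : ℝ := (N : ℝ) ^ (1 / (r : ℝ)) with hz
  have hz1 : 1 ≤ z := Real.one_le_rpow (by exact_mod_cast (by omega : 1 ≤ N)) (by positivity)
  have hl' : (1 : ℝ) ≤ l := by exact_mod_cast hl
  have h2l : ((2 * l - 1 : ℕ) : ℝ) ≤ 2 * (l : ℝ) ^ 2 := by
    have : ((2 * l - 1 : ℕ) : ℝ) ≤ 2 * l := by exact_mod_cast Nat.sub_le _ _
    nlinarith
  have hB4 : (B : ℝ) + 1 ≤ 4 * z := by linarith
  have hlog : (c : ℝ) ≤ 3 * Real.log ((N : ℝ) + (R : ℝ) + 2) := by exact_mod_cast hc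
  have hlog0 : 0 ≤ 3 * Real.log ((N : ℝ) + (R : ℝ) + 2) := (Nat.cast_nonneg c).trans hlog
  calc (((r + 2 * l + 1) * (c * ((2 * l - 1) * (B + 1))) : ℕ) : ℝ)
      = ((r + 2 * l + 1 : ℕ) : ℝ) * ((c : ℝ) * (((2 * l - 1 : ℕ) : ℝ) * ((B : ℝ) + 1))) := by
        rw [Nat.cast_mul, Nat.cast_mul, Nat.cast_mul, Nat.cast_add B 1, Nat.cast_one]
    _ ≤ ((r + 2 * l + 1 : ℕ) : ℝ) * (3 * Real.log ((N : ℝ) + (R : ℝ) + 2) *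
          (2 * (l : ℝ) ^ 2 * (4 * z))) := by gcongr
    _ = _ := by ring
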